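/- Let $\mathbf F$ be $\mathbb R$ or $\mathbb C$; locally convex spaces are Hausdorff locally convex spaces over $\mathbf F$. A topological space $Y$ is called $\kappa$-Fréchet–Urysohn if for every open subset $U$ of $Y$ and every $x\in\overline U$ there is a sequence $\{x_n\}_{n\in\mathbb N}\subseteq U$ converging to $x$. A free locally convex space on a Tychonoff (that is, completely regular Hausdorff) space $X$ is a locally convex space $L(X)$ together with a continuous map $i:X\to L(X)$ such that for every continuous map $f$ from $X$ to a locally convex space $E$ there is a unique continuous linear operator $\bar f:L(X)\to E$ with $f=\bar f\circ i$; it always exists and is essentially unique. Let $X$ be a Tychonoff space. Then $L(X)$ is a $\kappa$-Fréchet–Urysohn space if and only if $X$ is finite. -/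

import Mathlib

open Filter Topology
open scoped ComplexOrder

universe u

/-- A topological space `X` is *κ-Fréchet–Urysohn* if for every open set `U` and every point `x` in
the closure of `U` there is a sequence of points of `U` that converges to `x`. -/
def IsKappaFrechetUrysohn (X : Type*) [TopologicalSpace X] : Prop :=
  ∀ U : Set X, IsOpen U → ∀ x ∈ closure U,
    ∃ u : ℕ → X, (∀ n, u n ∈ U) ∧ Tendsto u atTop (𝓝 x)

/-- The pair `(L, i)` is a *free locally convex space* over the topological space `X`: the space `L`
is a (Hausdorff) locally convex space over `𝕜`, where `𝕜` is `ℝ` or `ℂ`, the map `i : X → L` is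
continuous, and for every continuous map `f` from `X` to a (Hausdorff) locally convex space `E`
there is a unique continuous linear operator `F : L → E` with `f = F ∘ i`.

In the scope of `ComplexOrder` the nonnegative scalars of `𝕜` are the nonnegative reals, so that
`Convex 𝕜` is ordinary convexity, and `LocallyConvexSpace 𝕜 E` is ordinary local convexity. -/
structure IsFreeLocallyConvexSpace (𝕜 : Type) [RCLike 𝕜] (X : Type u) [TopologicalSpace X]
    (L : Type u) [AddCommGroup L] [Module 𝕜 L] [TopologicalSpace L] (i : X → L) : Prop where
  isTopologicalAddGroup : IsTopologicalAddGroup L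
  continuousSMul : ContinuousSMul 𝕜 L
  locallyConvexSpace : LocallyConvexSpace 𝕜 L
  t2Space : T2Space L
  continuous : Continuous i
  existsUnique_lift : ∀ (E : Type u) [AddCommGroup E] [Module 𝕜 E] [TopologicalSpace E]
    [IsTopologicalAddGroup E] [ContinuousSMul 𝕜 E] [LocallyConvexSpace 𝕜 E] [T2Space E]
    (f : X → E), Continuous f → ∃! F : L →L[𝕜] E, f = F ∘ i

namespace FreeLocallyConvexSpace

/-! The free locally convex space exists: it is the vector space `X →₀ 𝕜` of finitely supported
functions, with the topology given by all seminorms `p` for which the canonical map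
`x ↦ single x 1` is continuous. -/

variable (𝕜 : Type) [RCLike 𝕜] (X : Type u) [TopologicalSpace X]

/-- The seminorms on `X →₀ 𝕜` for which the canonical map from `X` is continuous. -/
def seminorms : SeminormFamily 𝕜 (X →₀ 𝕜)
    {p : Seminorm 𝕜 (X →₀ 𝕜) //
      ∀ x, Tendsto (fun y => p (Finsupp.single y 1 - Finsupp.single x 1)) (𝓝 x) (𝓝 0)} :=
  fun p => p.1

/-- The topology of the free locally convex space on `X →₀ 𝕜`. -/
@[reducible]
noncomputable def topology : TopologicalSpace (X →₀ 𝕜) :=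
  (seminorms 𝕜 X).moduleFilterBasis.topology

/-- Existence of the free locally convex space over a Tychonoff space. -/
theorem isFree [T35Space X] :
    letI := topology 𝕜 X
    IsFreeLocallyConvexSpace 𝕜 X (X →₀ 𝕜) (fun x => Finsupp.single x 1) := by
  let _ := topology 𝕜 X
  have hp : WithSeminorms (seminorms 𝕜 X) := ⟨rfl⟩
  have := hp.topologicalAddGroup
  have := hp.continuousSMul
  have hT1 : T1Space (X →₀ 𝕜) := by
    refine hp.T1_of_separating fun v hv => ?_
    obtain ⟨x, hx⟩ := Finsupp.ne_iff.1 hv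
    classical
    obtain ⟨g, hg, hgx, hgK⟩ := CompletelyRegularSpace.completely_regular x
      (↑(v.support.erase x) : Set X) (Finset.finite_toSet _).isClosed (by simp)
    let h : X → 𝕜 := fun y => ((1 - (g y : ℝ) : ℝ) : 𝕜)
    have hh : Continuous h := by fun_prop
    let q : Seminorm 𝕜 (X →₀ 𝕜) :=
      (normSeminorm 𝕜 𝕜).comp (Finsupp.linearCombination 𝕜 h)
    have hq : ∀ x, Tendsto (fun y => q (Finsupp.single y 1 - Finsupp.single x 1)) (𝓝 x) (𝓝 0) := by
      intro x
      have : Tendsto (fun y => ‖h y - h x‖) (𝓝 x) (𝓝 ‖h x - h x‖) :=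
        ((hh.sub continuous_const).norm).tendsto x
      simpa [q] using this
    refine ⟨⟨q, hq⟩, ?_⟩
    have : Finsupp.linearCombination 𝕜 h v = v x := by
      rw [Finsupp.linearCombination_apply, Finsupp.sum, Finset.sum_eq_single x]
      · simp [h, hgx]
      · intro y hy hyx
        have : g y = 1 := hgK (by simp [hyx, Finsupp.mem_support_iff.1 hy])
        simp [h, this]
      · intro hx'
        simp [Finsupp.notMem_support_iff.1 hx']
    change ‖Finsupp.linearCombination 𝕜 h v‖ ≠ 0
    rw [this]
    exact norm_ne_zero_iff.2 hx
  refine ⟨inferInstance, inferInstance, ?_, inferInstance, ?_, ?_⟩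
  · have : LocallyConvexSpace ℝ (X →₀ 𝕜) := hp.toLocallyConvexSpace
    refine ⟨fun x => ?_⟩
    refine (LocallyConvexSpace.convex_basis (𝕜 := ℝ) x).to_hasBasis
      (fun s hs => ⟨s, ⟨hs.1, ?_⟩, subset_rfl⟩) (fun s hs => ⟨s, ⟨hs.1, ?_⟩, subset_rfl⟩)
    · exact convex_of_nonneg_surjective_algebraMap _
        (fun _ => RCLike.nonneg_iff_exists_ofReal.mp) hs.2
    · exact hs.2.lift ℝ
  · rw [continuous_iff_continuousAt]
    intro x
    refine (hp.tendsto_nhds _ _).2 fun p ε hε => ?_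
    exact (p.2 x).eventually (gt_mem_nhds hε)
  · intro E _ _ _ _ _ _ _ f hf
    let _ : Module ℝ E := Module.compHom E (algebraMap ℝ 𝕜)
    have _ : IsScalarTower ℝ 𝕜 E := IsScalarTower.of_algebraMap_smul fun _ _ => rfl
    have _ : ContinuousSMul ℝ E := IsScalarTower.continuousSMul 𝕜
    have := LocallyConvexSpace.toPolynormableSpace (𝕜 := 𝕜) (E := E)
    have hE := PolynormableSpace.withSeminorms 𝕜 E
    have hc : Continuous (Finsupp.linearCombination 𝕜 f) := by
      refine hE.continuous_of_continuous_comp _ fun q => ?_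
      refine hp.continuous_seminorm ⟨q.1.comp (Finsupp.linearCombination 𝕜 f), fun x => ?_⟩
      have : Tendsto (fun y => q.1 (f y - f x)) (𝓝 x) (𝓝 (q.1 (f x - f x))) :=
        (q.2.comp (hf.sub continuous_const)).tendsto x
      simpa using this
    refine ⟨⟨Finsupp.linearCombination 𝕜 f, hc⟩, by ext; simp, fun F hF => ?_⟩
    ext1 v
    induction v using Finsupp.induction_linear with
    | zero => simp
    | add v w hv hw => rw [map_add, map_add, hv, hw]
    | single x c =>
      have h1 : f x = F (Finsupp.single x 1) := congr_fun hF x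
      have h2 : Finsupp.single x c = c • Finsupp.single x (1 : 𝕜) := by simp
      rw [h2, map_smul, map_smul, ← h1]
      simp

end FreeLocallyConvexSpace

/-! By uniqueness, `L(X)` may be taken to be `X →₀ 𝕜`, viewed as finitely supported measures. For
finite `X` it is finite-dimensional, hence metrizable. For infinite `X` an open set `U` has `0` in
its closure, but no sequence in `U` tends to `0`.

If `x` is not isolated, `U` asks that |total mass| times total variation exceed 1. Near `0` there
are measures of small mass and large variation, since `δ_y - δ_x` is small for `y` near `x`; but
along a null sequence the variation is bounded and the mass tends to `0`
(`exists_norm_linearCombination_le`).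

If `X` is discrete, every seminorm is continuous. Here `U` makes a null sequence charge infinitely
many distinct points, which a weighted `ℓ¹` seminorm forbids (`not_tendsto_zero_of_injective`). -/

theorem IsKappaFrechetUrysohn.of_homeomorph {Y Z : Type*} [TopologicalSpace Y]
    [TopologicalSpace Z] (e : Y ≃ₜ Z) (h : IsKappaFrechetUrysohn Y) :
    IsKappaFrechetUrysohn Z := by
  intro U hU z hz
  obtain ⟨u, hu, hlim⟩ := h (e ⁻¹' U) (hU.preimage e.continuous) (e.symm z) (by
    rw [← e.preimage_closure]
    simpa using hz)
  refine ⟨fun n => e (u n), hu, ?_⟩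
  simpa [Function.comp_def] using (e.continuous.tendsto (e.symm z)).comp hlim

theorem IsKappaFrechetUrysohn.of_frechetUrysohnSpace {Y : Type*} [TopologicalSpace Y]
    [FrechetUrysohnSpace Y] : IsKappaFrechetUrysohn Y :=
  fun _ _ _ hx => mem_closure_iff_seq_limit.1 hx

/-- Free locally convex spaces over the same space are isomorphic. -/
theorem IsFreeLocallyConvexSpace.nonempty_equiv {𝕜 : Type} [RCLike 𝕜] {X : Type u}
    [TopologicalSpace X]
    {L : Type u} [AddCommGroup L] [Module 𝕜 L] [TopologicalSpace L] {i : X → L}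
    {M : Type u} [AddCommGroup M] [Module 𝕜 M] [TopologicalSpace M] {j : X → M}
    (hL : IsFreeLocallyConvexSpace 𝕜 X L i) (hM : IsFreeLocallyConvexSpace 𝕜 X M j) :
    Nonempty (L ≃L[𝕜] M) := by
  obtain ⟨_, _, _, _, hi, hLl⟩ := hL
  obtain ⟨_, _, _, _, hj, hMl⟩ := hM
  obtain ⟨F, hF, -⟩ := hLl M j hj
  obtain ⟨G, hG, -⟩ := hMl L i hi
  have h1 : G.comp F = ContinuousLinearMap.id 𝕜 L :=
    (hLl L i hi).unique (by rw [ContinuousLinearMap.coe_comp, Function.comp_assoc, ← hF, ← hG])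
      (by simp)
  have h2 : F.comp G = ContinuousLinearMap.id 𝕜 M :=
    (hMl M j hj).unique (by rw [ContinuousLinearMap.coe_comp, Function.comp_assoc, ← hG, ← hF])
      (by simp)
  exact ⟨ContinuousLinearEquiv.equivOfInverse F G (fun x => congr($h1 x)) (fun x => congr($h2 x))⟩

namespace FreeLocallyConvexSpace

/-- The weighted `ℓ¹` seminorm on finitely supported functions. -/
noncomputable def weightedSeminorm {𝕜 : Type} [RCLike 𝕜] {X : Type u} (w : X → ℝ) (hw : ∀ x, 0 ≤ w x) : Seminorm 𝕜 (X →₀ 𝕜) :=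
  have hs (v : X →₀ 𝕜) : Summable fun x => w x * ‖v x‖ :=
    summable_of_ne_finset_zero (s := v.support) fun x hx => by
      simp [Finsupp.notMem_support_iff.1 hx]
  Seminorm.of (fun v => ∑' x, w x * ‖v x‖)
    (fun v v' => by
      rw [← (hs v).tsum_add (hs v')]
      refine (hs _).tsum_le_tsum (fun x => ?_) ((hs v).add (hs v'))
      rw [← mul_add]
      exact mul_le_mul_of_nonneg_left (norm_add_le _ _) (hw x))
    (fun c v => by
      rw [← tsum_mul_left]
      exact tsum_congr fun x => by simp [mul_left_comm])

theorem le_weightedSeminorm {𝕜 : Type} [RCLike 𝕜] {X : Type u} (w : X → ℝ) (hw : ∀ x, 0 ≤ w x) (v : X →₀ 𝕜) (x : X) :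
    w x * ‖v x‖ ≤ weightedSeminorm w hw v := by
  have hs : Summable fun x => w x * ‖v x‖ :=
    summable_of_ne_finset_zero (s := v.support) fun x hx => by
      simp [Finsupp.notMem_support_iff.1 hx]
  exact hs.le_tsum x fun y _ => mul_nonneg (hw y) (norm_nonneg _)

attribute [local instance] topology

section

variable (𝕜 : Type) [RCLike 𝕜] (X : Type u) [TopologicalSpace X]

theorem withSeminorms : WithSeminorms (seminorms 𝕜 X) := ⟨rfl⟩

theorem isTopologicalAddGroup : IsTopologicalAddGroup (X →₀ 𝕜) :=
  (withSeminorms 𝕜 X).topologicalAddGroup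

theorem continuousSMul : ContinuousSMul 𝕜 (X →₀ 𝕜) :=
  (withSeminorms 𝕜 X).continuousSMul

attribute [local instance] isTopologicalAddGroup continuousSMul

variable {𝕜 X}

theorem continuous_single_one : Continuous fun x : X => Finsupp.single x (1 : 𝕜) := by
  rw [continuous_iff_continuousAt]
  intro x
  refine ((withSeminorms 𝕜 X).tendsto_nhds _ _).2 fun p ε hε => ?_
  exact (p.2 x).eventually (gt_mem_nhds hε)

theorem continuous_linearCombination {f : X → 𝕜} (hf : Continuous f) :
    Continuous (Finsupp.linearCombination 𝕜 f) := by
  refine (norm_withSeminorms 𝕜 𝕜).continuous_of_continuous_comp _ fun _ => ?_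
  refine (withSeminorms 𝕜 X).continuous_seminorm
    ⟨(normSeminorm 𝕜 𝕜).comp (Finsupp.linearCombination 𝕜 f), fun x => ?_⟩
  have : Tendsto (fun y => ‖f y - f x‖) (𝓝 x) (𝓝 ‖f x - f x‖) :=
    ((hf.sub continuous_const).norm).tendsto x
  simpa using this

/-- Every neighbourhood of zero contains a small positive multiple of a given vector. -/
theorem exists_pos_smul_mem {W : Set (X →₀ 𝕜)} (hW : W ∈ 𝓝 0) (v : X →₀ 𝕜) :
    ∃ a : ℝ, 0 < a ∧ (a : 𝕜) • v ∈ W := by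
  have h : Tendsto (fun a : ℝ => (a : 𝕜) • v) (𝓝 0) (𝓝 0) := by
    have : Continuous fun a : ℝ => (a : 𝕜) • v := by fun_prop
    simpa using this.tendsto 0
  obtain ⟨a, ha, ha0⟩ := (((h.eventually hW).filter_mono nhdsWithin_le_nhds).and
    (self_mem_nhdsWithin : Set.Ioi (0 : ℝ) ∈ 𝓝[>] 0)).exists
  exact ⟨a, ha0, ha⟩

/-- By Banach–Steinhaus on the bounded continuous functions, the total variation norms of a
convergent sequence of finitely supported measures are bounded. -/
theorem exists_norm_linearCombination_le {u : ℕ → X →₀ 𝕜} {v : X →₀ 𝕜}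
    (hu : Tendsto u atTop (𝓝 v)) :
    ∃ C : ℝ, ∀ n, ∀ f : BoundedContinuousFunction X 𝕜, ‖f‖ ≤ 1 →
      ‖Finsupp.linearCombination 𝕜 f (u n)‖ ≤ C := by
  -- Measures act as functionals on a Banach space, where pointwise bounds become uniform.
  let T : (X →₀ 𝕜) → BoundedContinuousFunction X 𝕜 →L[𝕜] 𝕜 :=
    Finsupp.linearCombination 𝕜 fun x => BoundedContinuousFunction.evalCLM 𝕜 x
  have hT (w : X →₀ 𝕜) (f : BoundedContinuousFunction X 𝕜) :
      T w f = Finsupp.linearCombination 𝕜 f w := by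
    simp [T, Finsupp.linearCombination_apply, Finsupp.sum]
  obtain ⟨C, hC⟩ := banach_steinhaus (g := fun n => T (u n)) fun f => by
    have h := ((continuous_linearCombination f.continuous).tendsto v).comp hu
    obtain ⟨C, hC⟩ := h.norm.bddAbove_range
    exact ⟨C, fun n => by
      rw [hT]
      exact hC ⟨n, rfl⟩⟩
  refine ⟨C, fun n f hf => ?_⟩
  rw [← hT]
  exact ((T (u n)).le_opNorm f).trans
    ((mul_le_of_le_one_right (norm_nonneg _) hf).trans (hC n))

theorem not_isKappaFrechetUrysohn_of_not_isolated [T35Space X] (x : X) [(𝓝[≠] x).NeBot] :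
    ¬ IsKappaFrechetUrysohn (X →₀ 𝕜) := by
  intro hκ
  let σ : (X →₀ 𝕜) → 𝕜 := Finsupp.linearCombination 𝕜 fun _ : X => (1 : 𝕜)
  have hσ : Continuous σ := continuous_linearCombination continuous_const
  let U : Set (X →₀ 𝕜) := ⋃ f : {f : BoundedContinuousFunction X 𝕜 // ‖f‖ ≤ 1},
    {v | 1 < ‖σ v‖ * ‖Finsupp.linearCombination 𝕜 f.1 v‖}
  have hU : IsOpen U := isOpen_iUnion fun f => isOpen_lt continuous_const
    (hσ.norm.mul (continuous_linearCombination f.1.continuous).norm)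
  have h0 : (0 : X →₀ 𝕜) ∈ closure U := by
    rw [mem_closure_iff_nhds]
    intro W hW
    obtain ⟨V, hV, hVW⟩ := exists_nhds_zero_half hW
    obtain ⟨a, ha, haV⟩ := exists_pos_smul_mem hV (Finsupp.single x (1 : 𝕜))
    -- `M` is fixed before `y`, so `y` can be taken close enough to `x` to make `M • (δ_y - δ_x)`
    -- small. Adding it to `a • δ_x` keeps the mass `a`, and `a * M = 2 > 1`.
    let M : ℝ := 2 / a
    have hM : Tendsto (fun y => (M : 𝕜) • (Finsupp.single y (1 : 𝕜) - Finsupp.single x 1))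
        (𝓝[≠] x) (𝓝 0) := by
      have : Continuous fun y => (M : 𝕜) • (Finsupp.single y (1 : 𝕜) - Finsupp.single x 1) :=
        (continuous_single_one.sub continuous_const).const_smul (M : 𝕜)
      simpa using (this.tendsto x).mono_left nhdsWithin_le_nhds
    obtain ⟨y, hyV, hyx⟩ := ((hM.eventually hV).and self_mem_nhdsWithin).exists
    obtain ⟨g, hg, hgx, hgy⟩ := CompletelyRegularSpace.completely_regular x {y}
      isClosed_singleton (by simpa using Ne.symm hyx)
    have hgy : g y = 1 := hgy rfl
    -- As `f` is 0 at `x` and 1 at `y`, it detects exactly the coefficient `M` of `δ_y`.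
    let f : BoundedContinuousFunction X 𝕜 := BoundedContinuousFunction.ofNormedAddCommGroup
      (fun z => ((g z : ℝ) : 𝕜)) (by fun_prop) 1 fun z => by
        simpa [abs_of_nonneg (g z).2.1] using (g z).2.2
    have hf : ‖f‖ ≤ 1 := BoundedContinuousFunction.norm_ofNormedAddCommGroup_le _ zero_le_one _
    refine ⟨_, hVW _ haV _ hyV, Set.mem_iUnion.2 ⟨⟨f, hf⟩, ?_⟩⟩
    have h1 : σ ((a : 𝕜) • Finsupp.single x (1 : 𝕜) +
        (M : 𝕜) • (Finsupp.single y (1 : 𝕜) - Finsupp.single x 1)) = (a : 𝕜) := by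
      simp [σ, smul_sub, RCLike.real_smul_eq_coe_mul]
    have h2 : Finsupp.linearCombination 𝕜 f ((a : 𝕜) • Finsupp.single x (1 : 𝕜) +
        (M : 𝕜) • (Finsupp.single y (1 : 𝕜) - Finsupp.single x 1)) = (M : 𝕜) := by
      simp [f, hgx, hgy, smul_sub, RCLike.real_smul_eq_coe_mul]
    have hMa : a * (2 / a) = 2 := by field_simp
    have hM0 : 0 < M := by positivity
    rw [Set.mem_ofPred_eq, h1, h2, RCLike.norm_ofReal, RCLike.norm_ofReal, abs_of_pos ha,
      abs_of_pos hM0, hMa]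
    norm_num
  obtain ⟨u, huU, hu⟩ := hκ U hU 0 h0
  obtain ⟨C, hC⟩ := exists_norm_linearCombination_le hu
  have hlim : Tendsto (fun n => ‖σ (u n)‖ * C) atTop (𝓝 0) := by
    have := ((hσ.tendsto 0).comp hu).norm.mul_const C
    simpa [σ] using this
  obtain ⟨n, hn⟩ := (hlim.eventually (gt_mem_nhds zero_lt_one)).exists
  obtain ⟨f, hf⟩ := Set.mem_iUnion.1 (huU n)
  have := mul_le_mul_of_nonneg_left (hC n f.1 f.2) (norm_nonneg (σ (u n)))
  exact lt_irrefl _ ((hf.trans_le this).trans hn)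

/-- Over a discrete space, a null sequence cannot be nonzero at pairwise distinct points. -/
theorem not_tendsto_zero_of_injective [DiscreteTopology X] {u : ℕ → X →₀ 𝕜} {y : ℕ → X}
    (hy : Function.Injective y) (hne : ∀ n, u n (y n) ≠ 0) : ¬ Tendsto u atTop (𝓝 0) := by
  intro hu
  -- These weights make the term of `u n` at `y n` equal to 1, so the seminorm of every `u n` is at
  -- least 1.
  let w : X → ℝ := Function.extend y (fun n => ‖u n (y n)‖⁻¹) 0
  have hw (x : X) : 0 ≤ w x := by
    by_cases hx : ∃ n, y n = x
    · obtain ⟨n, rfl⟩ := hx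
      simp [w, hy.extend_apply]
    · simp [w, Function.extend_apply' _ _ _ hx]
  have h := ((withSeminorms 𝕜 X).tendsto_nhds _ _).1 hu ⟨weightedSeminorm w hw, fun x => by
    rw [nhds_discrete, tendsto_pure_left]
    intro s hs
    simpa using mem_of_mem_nhds hs⟩ 1 one_pos
  obtain ⟨n, hn⟩ := h.exists
  have hle := le_weightedSeminorm w hw (u n) (y n)
  have h1 : w (y n) * ‖u n (y n)‖ = 1 := by
    simp [w, hy.extend_apply, hne n]
  rw [h1] at hle
  rw [sub_zero] at hn
  exact hle.not_gt hn

theorem not_isKappaFrechetUrysohn_of_discrete [DiscreteTopology X] [Infinite X] :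
    ¬ IsKappaFrechetUrysohn (X →₀ 𝕜) := by
  intro hκ
  let x : ℕ → X := Infinite.natEmbedding X
  have hx : Function.Injective x := (Infinite.natEmbedding X).injective
  have hcoord (z : X) : Continuous fun v : X →₀ 𝕜 => v z := by
    classical
    have := continuous_linearCombination (𝕜 := 𝕜) (X := X) (f := Pi.single z 1)
      continuous_of_discreteTopology
    convert this using 2 with v
    simp [Finsupp.linearCombination_apply, Finsupp.sum, Pi.single_apply, eq_comm]
  -- A small coefficient at `x 0` forces a large `n`, hence a nonzero coefficient far along the
  -- sequence; the shift to `n + 1` keeps that point away from `x 0`.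
  let U : Set (X →₀ 𝕜) := ⋃ n : ℕ, {v | 1 < ‖v (x 0)‖ * n} ∩ {v | v (x (n + 1)) ≠ 0}
  have hU : IsOpen U := isOpen_iUnion fun n =>
    (isOpen_lt continuous_const ((hcoord _).norm.mul continuous_const)).inter
      (isOpen_ne_fun (hcoord _) continuous_const)
  have h0 : (0 : X →₀ 𝕜) ∈ closure U := by
    rw [mem_closure_iff_nhds]
    intro W hW
    obtain ⟨V, hV, hVW⟩ := exists_nhds_zero_half hW
    obtain ⟨a, ha, haV⟩ := exists_pos_smul_mem hV (Finsupp.single (x 0) (1 : 𝕜))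
    obtain ⟨n, hn⟩ := exists_nat_gt (1 / a)
    obtain ⟨b, hb, hbV⟩ := exists_pos_smul_mem hV (Finsupp.single (x (n + 1)) (1 : 𝕜))
    have hne : x 0 ≠ x (n + 1) := hx.ne (by omega)
    refine ⟨_, hVW _ haV _ hbV, Set.mem_iUnion.2 ⟨n, ?_, ?_⟩⟩
    · have : 1 < a * n := by rwa [div_lt_iff₀' ha] at hn
      simpa [hne.symm, hne, abs_of_pos ha] using this
    · simpa [hne.symm, hne] using hb.ne'
  obtain ⟨u, huU, hu⟩ := hκ U hU 0 h0
  choose m hm1 hm2 using fun k => Set.mem_iUnion.1 (huU k)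
  have hlim : Tendsto (fun k => ‖u k (x 0)‖) atTop (𝓝 0) := by
    have := (((hcoord (x 0)).tendsto 0).comp hu).norm
    simpa [Function.comp_def] using this
  have hm : Tendsto m atTop atTop := by
    refine tendsto_atTop.2 fun N => ?_
    have := (hlim.mul_const (N : ℝ)).eventually_lt_const (u := 1) (by simp)
    filter_upwards [this] with k hk
    by_contra! hlt
    have h1 : (m k : ℝ) ≤ N := by exact_mod_cast hlt.le
    have h2 := mul_le_mul_of_nonneg_left h1 (norm_nonneg (u k (x 0)))
    exact lt_irrefl _ (((hm1 k).trans_le h2).trans hk)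
  obtain ⟨φ, hφ, hmφ⟩ := strictMono_subseq_of_tendsto_atTop hm
  refine not_tendsto_zero_of_injective (u := u ∘ φ) (y := fun k => x (m (φ k) + 1)) ?_
    (fun k => hm2 (φ k)) (hu.comp hφ.tendsto_atTop)
  intro k l hkl
  exact hmφ.injective (Nat.succ_injective (hx hkl))

theorem not_isKappaFrechetUrysohn_of_infinite [T35Space X] [Infinite X] :
    ¬ IsKappaFrechetUrysohn (X →₀ 𝕜) := by
  by_cases h : ∃ x : X, (𝓝[≠] x).NeBot
  · obtain ⟨x, _⟩ := h
    exact not_isKappaFrechetUrysohn_of_not_isolated x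
  · simp only [not_exists] at h
    have : DiscreteTopology X := discreteTopology_iff_nhds_ne.2 fun x => not_neBot.1 (h x)
    exact not_isKappaFrechetUrysohn_of_discrete

theorem isKappaFrechetUrysohn_of_finite [T35Space X] [Finite X] :
    IsKappaFrechetUrysohn (X →₀ 𝕜) := by
  have : T2Space (X →₀ 𝕜) := (isFree 𝕜 X).t2Space
  -- A finite-dimensional space has only one Hausdorff vector topology.
  have e : (X →₀ 𝕜) ≃L[𝕜] (X → 𝕜) :=
    (Finsupp.linearEquivFunOnFinite 𝕜 𝕜 X).toContinuousLinearEquiv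
  exact IsKappaFrechetUrysohn.of_frechetUrysohnSpace.of_homeomorph e.symm.toHomeomorph

end

end FreeLocallyConvexSpace

theorem corollary2p12 (𝕜 : Type) [RCLike 𝕜] (X : Type u) [TopologicalSpace X] [T35Space X]
    (L : Type u) [AddCommGroup L] [Module 𝕜 L] [TopologicalSpace L] (i : X → L)
    (hL : IsFreeLocallyConvexSpace 𝕜 X L i) :
    IsKappaFrechetUrysohn L ↔ Finite X := by
  let _ := FreeLocallyConvexSpace.topology 𝕜 X
  obtain ⟨e⟩ := hL.nonempty_equiv (FreeLocallyConvexSpace.isFree 𝕜 X)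
  refine ⟨fun h => ?_, fun h => ?_⟩
  · by_contra hX
    rw [not_finite_iff_infinite] at hX
    exact FreeLocallyConvexSpace.not_isKappaFrechetUrysohn_of_infinite
      (h.of_homeomorph e.toHomeomorph)
  · exact FreeLocallyConvexSpace.isKappaFrechetUrysohn_of_finite.of_homeomorph
      e.symm.toHomeomorph
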